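/- **Setting.** Let $U$ be a finite set of $n$ elements. Every $e\in U$ has a value $v(e)\in\mathbb{Z}$ and a size $s(e)\in\mathbb{Z}$, $s(e)\ge 1$, and the densities $\rho(e)=v(e)/s(e)$ are pairwise distinct. Let $C:\mathbb{Z}_{\ge 0}\to\mathbb{Z}_{\ge 0}$ be convex and non-decreasing with $C(0)=0$, extended piecewise linearly to the non-negative reals. For $A\subseteq U$ put $v(A)=\sum_{e\in A}v(e)$, $s(A)=\sum_{e\in A}s(e)$ and $\pi(A)=v(A)-C(s(A))$; for a fractional set $x\in[0,1]^U$ put $\pi(x)=\sum_e x_e v(e)-C\left(\sum_e x_e s(e)\right)$. Let $\mathbb{I}$ be the set of all $e\in U$ for which $\alpha=1$ maximizes $\alpha\mapsto\pi(\alpha e)$ over $\alpha\in[0,1]$, where $\alpha e$ is the fractional set with $x_e=\alpha$ and all other coordinates $0$. For $T\subseteq U$ let $\pi(F^*(T))$ be the maximum of $\pi(x)$ over the fractional sets $x$ supported on $T\cap\mathbb{I}$, and for a density $\gamma$ let $P_\gamma^T=\{e\in T\cap\mathbb{I}:\rho(e)\ge\gamma\}$. **Algorithm.** Put $\beta=0.262$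 and $k_1=112$. The elements of $U$ arrive in uniformly random order; $n$ and $C$ are known, and the value and the size of an element are revealed when it arrives. The algorithm flips a fair coin. * On heads it runs the classical (Dynkin) secretary algorithm: it rejects the first $\lfloor n/e\rfloor$ elements (here $e$ is Euler's number), and then accepts the first element that has higher profit $\pi(\{\cdot\})$ than all elements that arrived before it (ties in profit are broken by density) and whose profit is not negative; it accepts no other element. * On tails it draws $k$ from $\mathrm{Binomial}(n,1/2)$ and rejects the first $k$ elements, which form the sample $X$. Let $\tau$ be the largest density $\rho(e)$ of an element $e\in X\cap\mathbb{I}$ such that $\pi(P^X_{\rho(e)})\ge\beta\left(1-\frac1{k_1}\right)\pi(F^*(X))$, and $\tau=\infty$ if there is none. It starts with $O=\emptyset$ and goes through the later elements $i$ in the order of arrival: it adds $i$ to $O$ if $\pi(O\cup\{i\})-\pi(O)\ge 0$, $\rho(i)\ge\tau$ and $i\in\mathbb{I}$, and skips $i$ otherwise. **Theorem.** The algorithm is $616$-competitive: its expected profit, over the random order, the coin and $k$, is at least $\frac{1}{616}\max_{A\subseteq U}\pi(A)$. -/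

import Mathlib

open scoped BigOperators

noncomputable section

/-- The data of a single-dimensional profit maximization problem on a universe `U` of elements:
every element has an integral value and an integral size, and a set of total size `t` has
cost `cost t`. -/
structure CostInstance (U : Type*) where
  value : U → ℤ
  size : U → ℕ
  cost : ℕ → ℕ

namespace CostInstance

section

open scoped Classical

variable {U : Type*} [Fintype U] (P : CostInstance U)

/-- The total value of a set. -/
def totalValue (A : Finset U) : ℤ := ∑ e ∈ A, P.value e

/-- The total size of a set. -/
def totalSize (A : Finset U) : ℕ := ∑ e ∈ A, P.size e

/-- The profit `v(A) - C(s(A))` of a set. -/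
def profit (A : Finset U) : ℝ := (P.totalValue A : ℝ) - (P.cost (P.totalSize A) : ℝ)

/-- The optimal profit over all subsets of the universe. -/
def optProfit : ℝ :=
  (Finset.univ : Finset (Finset U)).sup' Finset.univ_nonempty P.profit

/-- The density `v(e) / s(e)` of an element. -/
def density (e : U) : ℝ := (P.value e : ℝ) / (P.size e : ℝ)

/-- The piecewise linear extension of the cost function to nonnegative real sizes. -/
def costExt (x : ℝ) : ℝ :=
  (P.cost ⌊x⌋₊ : ℝ) + (x - (⌊x⌋₊ : ℝ)) * ((P.cost (⌊x⌋₊ + 1) : ℝ) - (P.cost ⌊x⌋₊ : ℝ))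

/-- The profit of the fractional set that contains the fraction `x e` of each element `e`. -/
def fracProfit (x : U → ℝ) : ℝ :=
  ∑ e, x e * (P.value e : ℝ) - P.costExt (∑ e, x e * (P.size e : ℝ))

/-- The set `𝕀` of the elements of which it is (weakly) optimal to take all rather than a strict
fraction: `α = 1` maximizes the profit of the fractional set `α e` over `α ∈ [0, 1]`. -/
def integralElems : Finset U :=
  Finset.univ.filter fun e =>
    ∀ α ∈ Set.Icc (0 : ℝ) 1, P.fracProfit (Pi.single e α) ≤ P.fracProfit (Pi.single e 1)

/-- The fractional subsets of `T ∩ 𝕀`. -/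
def fracSubsets (T : Finset U) : Set (U → ℝ) :=
  {x | (∀ e, x e ∈ Set.Icc (0 : ℝ) 1) ∧ ∀ e, x e ≠ 0 → e ∈ T ∩ P.integralElems}

/-- The profit of an optimal fractional subset of `T ∩ 𝕀`. -/
def fracOpt (T : Finset U) : ℝ := sSup (P.fracProfit '' P.fracSubsets T)

/-- The density prefix of `T ∩ 𝕀` at density `γ`. -/
def densityPrefix (T : Finset U) (γ : ℝ) : Finset U :=
  (T ∩ P.integralElems).filter fun e => γ ≤ P.density e

/-- The elements of `X ∩ 𝕀` whose density prefix in `X` has at least a `β (1 - 1 / k)` fraction of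
the optimal fractional profit over `X`. -/
def thresholdCandidates (β k : ℝ) (X : Finset U) : Finset U :=
  (X ∩ P.integralElems).filter fun e =>
    β * (1 - 1 / k) * P.fracOpt X ≤ P.profit (P.densityPrefix X (P.density e))

/-- The density threshold learned from the sample `X`: the largest density of a candidate, and
`⊤` (nothing will be accepted) if there is no candidate. -/
def threshold (β k : ℝ) (X : Finset U) : WithTop ℝ :=
  if h : (P.thresholdCandidates β k X).Nonempty then
    (((P.thresholdCandidates β k X).sup' h P.density : ℝ) : WithTop ℝ)
  else ⊤

/-- One step of the greedy phase: with the set `O` selected so far, `e` is accepted if it has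
nonnegative marginal profit, its density is at least the threshold, and it belongs to `𝕀`;
otherwise it is skipped. -/
def greedyStep (τ : WithTop ℝ) (O : Finset U) (e : U) : Finset U :=
  if 0 ≤ P.profit (insert e O) - P.profit O ∧ τ ≤ (P.density e : WithTop ℝ) ∧
      e ∈ P.integralElems then insert e O else O

/-- The set selected from the arrival sequence `l` when its first `k` elements are the sample:
they are rejected, and the later elements are treated greedily, in order of arrival. -/
def sampleAndGreedy (β k₁ : ℝ) (l : List U) (k : ℕ) : Finset U :=
  (l.drop k).foldl (P.greedyStep (P.threshold β k₁ (l.take k).toFinset)) ∅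

/-- The strict ranking of the elements by profit, where ties are broken by density. -/
def Better (a b : U) : Prop :=
  P.profit {b} < P.profit {a} ∨ (P.profit {b} = P.profit {a} ∧ P.density b < P.density a)

/-- The selection phase of the classical secretary algorithm: `seen` lists the elements that have
already been rejected. The first arriving element that is better than all elements seen before
is hired, provided that its profit is not negative. -/
def secretarySelect : List U → List U → Finset U
  | _, [] => ∅
  | seen, e :: rest =>
      if (∀ a ∈ seen, P.Better e a) ∧ 0 ≤ P.profit {e} then {e}
      else secretarySelect (e :: seen) rest

/-- The classical secretary algorithm (of Dynkin): the first `⌊n / e⌋` of the `n` elements are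
rejected, and then the first one that is better than all previous ones is hired. -/
def secretary (l : List U) : Finset U :=
  P.secretarySelect (l.take ⌊(l.length : ℝ) / Real.exp 1⌋₊)
    (l.drop ⌊(l.length : ℝ) / Real.exp 1⌋₊)

/-- The expected profit of the online algorithm with the constants `β` and `k₁`. The expectation
is over a uniformly random arrival order `σ`, over the fair coin that decides whether the
classical secretary algorithm is run, and over the sample size `k`, which has the binomial
distribution with parameters `n` and `1/2`. -/
def expectedProfit (β k₁ : ℝ) : ℝ :=
  𝔼 σ : Fin (Fintype.card U) ≃ U,
    (1 / 2 * P.profit (P.secretary (List.ofFn σ)) +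
      1 / 2 * ∑ k ∈ Finset.range (Fintype.card U + 1),
        ((Fintype.card U).choose k : ℝ) / 2 ^ Fintype.card U *
          P.profit (P.sampleAndGreedy β k₁ (List.ofFn σ) k))

end

end CostInstance

end

open scoped BigOperators

namespace CostInstance

/-! Everything is measured against one deterministic set, the core prefix: going down the integral
elements by density, continue while each element is at least as dense as the last unit of size is
expensive. Inside it profit is monotone (`DensityDominated.profit_mono`). Let M be its profit and m
≥ 0 a bound on every single-element profit. Lagrangian pricing of size shows that no fractional set
of integral elements earns more than M + m (`fracProfit_le`), and a set of non-integral elements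
earns at most m, so the optimum is at most M + 2m (`optProfit_le`).

If M ≤ 20m, the secretary branch suffices, since it earns at least m/10 when m is the best single
profit. Otherwise the binomial sample X is a uniformly random subset and two events matter.
Chebyshev, applied to an additive lower bound for profit, shows that X catches at least 0.273 M of
the core with probability at least 3/4. This forces the threshold into the core, where greedy takes
every unsampled element above it. The prefix it selects contains a fixed prefix J, the smallest one
earning 0.07 M. By subadditivity and the symmetry between X and its complement, the unsampled part
of J keeps half the profit of J with probability at least 1/2. Since J does not depend on X, a union
bound gives both events with probability at least 1/4. -/

/-- The standing assumptions on sizes, densities and the cost function. -/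
structure Regular {U : Type*} (P : CostInstance U) : Prop where
  size_pos : ∀ e, 0 < P.size e
  density_injective : Function.Injective P.density
  cost_zero : P.cost 0 = 0
  cost_mono : Monotone P.cost
  cost_convex : ∀ t, 2 * P.cost (t + 1) ≤ P.cost t + P.cost (t + 2)

/-! ### Discrete convexity of the cost. -/

section Cost

variable {U : Type*} {P : CostInstance U}

/-- The cost of the last unit of size, which is `0` at size `0`. -/
noncomputable def unitCost (P : CostInstance U) (t : ℕ) : ℝ :=
  (P.cost t : ℝ) - (P.cost (t - 1) : ℝ)

lemma unitCost_succ (t : ℕ) : P.unitCost (t + 1) = (P.cost (t + 1) : ℝ) - P.cost t := rfl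

lemma unitCost_zero : P.unitCost 0 = 0 := by simp [unitCost]

namespace Regular

variable (h : P.Regular)
include h

lemma cost_zero_real : (P.cost 0 : ℝ) = 0 := by simp [h.cost_zero]

lemma unitCost_mono : Monotone P.unitCost := by
  refine monotone_nat_of_le_succ fun t => ?_
  -- At 0 the truncated `t - 1` makes the unit cost 0, so this step needs monotonicity of the cost;
  -- convexity handles the rest.
  rcases t with _ | t
  · rw [unitCost_zero, unitCost_succ, sub_nonneg]
    exact_mod_cast h.cost_mono (Nat.zero_le 1)
  · rw [unitCost_succ, unitCost_succ]
    have := h.cost_convex t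
    have : (2 * P.cost (t + 1) : ℝ) ≤ P.cost t + P.cost (t + 2) := by exact_mod_cast this
    linarith

lemma cost_add_le (t d : ℕ) : (P.cost (t + d) : ℝ) ≤ P.cost t + P.unitCost (t + d) * d := by
  induction d with
  | zero => simp
  | succ d ih =>
    have h1 := unitCost_succ (P := P) (t + d)
    have h2 : P.unitCost (t + d) ≤ P.unitCost (t + d + 1) := h.unitCost_mono (Nat.le_succ _)
    have h3 : P.unitCost (t + d) * d ≤ P.unitCost (t + d + 1) * d := by gcongr
    rw [← add_assoc]
    push_cast
    linarith

lemma le_cost_add (t d : ℕ) : (P.cost t : ℝ) + P.unitCost (t + 1) * d ≤ P.cost (t + d) := by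
  induction d with
  | zero => simp
  | succ d ih =>
    have h1 := unitCost_succ (P := P) (t + d)
    have h2 : P.unitCost (t + 1) ≤ P.unitCost (t + d + 1) := h.unitCost_mono (by omega)
    rw [← add_assoc]
    push_cast
    linarith

/-- The line of slope `unitCost t` through the cost at `t` supports the cost function. -/
lemma unitCost_tangent (t n : ℕ) :
    (P.cost t : ℝ) + P.unitCost t * ((n : ℝ) - t) ≤ P.cost n := by
  rcases le_total t n with hn | hn
  · obtain ⟨d, rfl⟩ := Nat.exists_eq_add_of_le hn
    have h1 := h.le_cost_add t d
    have h2 : P.unitCost t ≤ P.unitCost (t + 1) := h.unitCost_mono (Nat.le_succ _)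
    have h3 : P.unitCost t * d ≤ P.unitCost (t + 1) * d := by gcongr
    push_cast
    linarith
  · obtain ⟨d, rfl⟩ := Nat.exists_eq_add_of_le hn
    have h1 := h.cost_add_le n d
    push_cast
    linarith

/-- A convex cost function has increasing differences. -/
lemma cost_increment_mono {a b : ℕ} (hab : a ≤ b) (d : ℕ) :
    (P.cost (a + d) : ℝ) - P.cost a ≤ P.cost (b + d) - P.cost b := by
  induction d with
  | zero => simp
  | succ d ih =>
    have h1 := unitCost_succ (P := P) (a + d)
    have h2 := unitCost_succ (P := P) (b + d)
    have h3 : P.unitCost (a + d + 1) ≤ P.unitCost (b + d + 1) := h.unitCost_mono (by omega)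
    rw [← add_assoc, ← add_assoc]
    linarith

lemma cost_superadditive (a b : ℕ) : (P.cost a : ℝ) + P.cost b ≤ P.cost (a + b) := by
  have := h.cost_increment_mono (Nat.zero_le a) b
  rw [h.cost_zero_real, zero_add] at this
  linarith

/-- The average cost is non-decreasing. -/
lemma cost_mul_le {t s : ℕ} (hts : t ≤ s) : (P.cost t : ℝ) * s ≤ P.cost s * t := by
  have h1 := h.unitCost_tangent t s
  have h2 := h.unitCost_tangent t 0
  rw [h.cost_zero_real] at h2
  have h3 : (0 : ℝ) ≤ s - t := sub_nonneg.2 (by exact_mod_cast hts)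
  have h4 : (0 : ℝ) ≤ t := Nat.cast_nonneg t
  push_cast at h2
  nlinarith

lemma cost_le_unitCost_mul (t : ℕ) : (P.cost t : ℝ) ≤ P.unitCost t * t := by
  have h2 := h.unitCost_tangent t 0
  rw [h.cost_zero_real] at h2
  push_cast at h2
  linarith

end Regular

lemma costExt_natCast (n : ℕ) : P.costExt n = P.cost n := by simp [costExt]

/-- The extended cost is an interpolation between neighbouring integers. -/
lemma costExt_le_of_forall_nat {a b x : ℝ} (hx : 0 ≤ x)
    (hn : ∀ n : ℕ, a * n - P.cost n ≤ b) : a * x - P.costExt x ≤ b := by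
  have h1 := hn ⌊x⌋₊
  have h2 := hn (⌊x⌋₊ + 1)
  have h3 := Nat.floor_le hx
  have h4 := (Nat.lt_floor_add_one x).le
  push_cast at h2
  unfold costExt
  nlinarith

end Cost

/-! ### Density-dominated sets and additive profit shares. -/

section Profit

open scoped Classical

variable {U : Type*} {P : CostInstance U}

lemma value_eq_density_mul (h : P.Regular) (e : U) :
    (P.value e : ℝ) = P.density e * P.size e := by
  have : (P.size e : ℝ) ≠ 0 := by exact_mod_cast (h.size_pos e).ne'
  rw [density, div_mul_cancel₀ _ this]

lemma profit_empty (h : P.Regular) : P.profit ∅ = 0 := by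
  simp [profit, totalValue, totalSize, h.cost_zero]

lemma profit_singleton (e : U) : P.profit {e} = P.value e - P.cost (P.size e) := by
  simp [profit, totalValue, totalSize]

lemma totalSize_mono {A B : Finset U} (hAB : A ⊆ B) : P.totalSize A ≤ P.totalSize B :=
  Finset.sum_le_sum_of_subset hAB

lemma size_le_totalSize {A : Finset U} {e : U} (he : e ∈ A) : P.size e ≤ P.totalSize A :=
  Finset.single_le_sum (f := P.size) (fun _ _ => Nat.zero_le _) he

lemma totalSize_insert {A : Finset U} {e : U} (he : e ∉ A) :
    P.totalSize (insert e A) = P.totalSize A + P.size e := by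
  rw [totalSize, Finset.sum_insert he, add_comm, totalSize]

lemma profit_insert {A : Finset U} {e : U} (he : e ∉ A) :
    P.profit (insert e A) = P.profit A +
      (P.value e - (P.cost (P.totalSize A + P.size e) - P.cost (P.totalSize A))) := by
  rw [profit, totalSize_insert he, totalValue, Finset.sum_insert he, profit, totalValue]
  push_cast
  ring

lemma profit_union_le (h : P.Regular) {A B : Finset U} (hAB : Disjoint A B) :
    P.profit (A ∪ B) ≤ P.profit A + P.profit B := by
  have := h.cost_superadditive (P.totalSize A) (P.totalSize B)
  simp only [profit, totalValue, totalSize, Finset.sum_union hAB] at this ⊢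
  push_cast
  linarith

/-- Inserting an element whose density is at least the final unit cost does no harm. -/
lemma profit_le_insert (h : P.Regular) {A : Finset U} {e : U}
    (he : P.unitCost (P.totalSize (insert e A)) ≤ P.density e) :
    P.profit A ≤ P.profit (insert e A) := by
  by_cases heA : e ∈ A
  · rw [Finset.insert_eq_of_mem heA]
  · rw [profit_insert heA, value_eq_density_mul h]
    rw [totalSize_insert heA] at he
    have h1 := h.cost_add_le (P.totalSize A) (P.size e)
    have h2 : P.unitCost (P.totalSize A + P.size e) * P.size e ≤ P.density e * P.size e := by
      gcongr
    linarith

/-- All elements of the set are at least as dense as its last unit of size is expensive. -/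
def DensityDominated (P : CostInstance U) (S : Finset U) : Prop :=
  ∀ e ∈ S, P.unitCost (P.totalSize S) ≤ P.density e

lemma DensityDominated.subset (h : P.Regular) {S T : Finset U} (hS : P.DensityDominated S)
    (hTS : T ⊆ S) : P.DensityDominated T := fun e he =>
  (h.unitCost_mono (totalSize_mono hTS)).trans (hS e (hTS he))

/-- The missing elements are inserted one at a time. Every intermediate set stays inside `S`, so the
inserted element is still at least as dense as the final unit cost. -/
lemma DensityDominated.profit_mono (h : P.Regular) {S A B : Finset U}
    (hS : P.DensityDominated S) (hAB : A ⊆ B) (hBS : B ⊆ S) : P.profit A ≤ P.profit B := by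
  have key : ∀ D : Finset U, D ⊆ B → P.profit A ≤ P.profit (D ∪ A) := by
    intro D hD
    induction D using Finset.induction_on with
    | empty => simp
    | insert d D hd ih =>
      obtain ⟨hdB, hDB⟩ := Finset.insert_subset_iff.1 hD
      refine (ih hDB).trans ?_
      rw [Finset.insert_union]
      refine profit_le_insert h ((hS.subset h ?_) d (Finset.mem_insert_self _ _))
      exact Finset.insert_subset (hBS hdB) ((Finset.union_subset hDB hAB).trans hBS)
  have := key B subset_rfl
  rwa [Finset.union_eq_left.2 hAB] at this

/-- The additive share of an element in the profit of the set `S`. -/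
noncomputable def profitShare (P : CostInstance U) (S : Finset U) (e : U) : ℝ :=
  P.value e - P.size e * (P.cost (P.totalSize S) / P.totalSize S)

lemma sum_profitShare (S T : Finset U) :
    ∑ e ∈ T, P.profitShare S e =
      P.totalValue T - P.totalSize T * (P.cost (P.totalSize S) / P.totalSize S) := by
  simp only [profitShare, Finset.sum_sub_distrib, ← Finset.sum_mul, totalValue, totalSize]
  push_cast
  rfl

lemma sum_profitShare_self (h : P.Regular) (S : Finset U) :
    ∑ e ∈ S, P.profitShare S e = P.profit S := by
  rw [sum_profitShare, profit]
  by_cases h0 : P.totalSize S = 0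
  · simp [h0, h.cost_zero]
  · have : (P.totalSize S : ℝ) ≠ 0 := by exact_mod_cast h0
    rw [mul_div_cancel₀ _ this]

/-- The shares charge `T` the average cost of `S`, which is at least its own average cost. This
makes shares an additive lower bound for profit, to which a variance argument applies. -/
lemma sum_profitShare_le (h : P.Regular) {S T : Finset U} (hT : T ⊆ S) :
    ∑ e ∈ T, P.profitShare S e ≤ P.profit T := by
  rw [sum_profitShare, profit]
  have hle := totalSize_mono (P := P) hT
  by_cases h0 : P.totalSize S = 0
  · have h1 : P.totalSize T = 0 := by omega
    simp [h0, h1, h.cost_zero]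
  · have : (0 : ℝ) < P.totalSize S := by exact_mod_cast Nat.pos_of_ne_zero h0
    have h2 := h.cost_mul_le hle
    have h3 : (P.cost (P.totalSize T) : ℝ) ≤
        P.totalSize T * (P.cost (P.totalSize S) / P.totalSize S) := by
      rw [← mul_div_assoc, le_div_iff₀ this]
      linarith
    linarith

lemma profitShare_le (h : P.Regular) {S : Finset U} {e : U} (he : e ∈ S) :
    P.profitShare S e ≤ P.profit {e} := by
  simpa using sum_profitShare_le h (Finset.singleton_subset_iff.2 he)

lemma DensityDominated.profitShare_nonneg (h : P.Regular) {S : Finset U}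
    (hS : P.DensityDominated S) {e : U} (he : e ∈ S) : 0 ≤ P.profitShare S e := by
  have h1 := hS e he
  have hpos : (0 : ℝ) < P.totalSize S := by
    exact_mod_cast (h.size_pos e).trans_le (size_le_totalSize he)
  have h2 := h.cost_le_unitCost_mul (P.totalSize S)
  have h3 : (P.cost (P.totalSize S) : ℝ) / P.totalSize S ≤ P.density e :=
    le_trans ((div_le_iff₀ hpos).2 h2) h1
  rw [profitShare, value_eq_density_mul h, sub_nonneg, mul_comm]
  gcongr

end Profit

end CostInstance

namespace CostInstance

/-! ### The core prefix and bounds on the fractional and integral optimum. -/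

section Fractional

open scoped Classical

variable {U : Type*} [Fintype U] {P : CostInstance U}

lemma fracProfit_single (e : U) (α : ℝ) :
    P.fracProfit (Pi.single e α) = α * P.value e - P.costExt (α * P.size e) := by
  simp [fracProfit, Pi.single_apply, ite_mul]

lemma fracProfit_indicator (A : Finset U) :
    P.fracProfit (fun e => if e ∈ A then 1 else 0) = P.profit A := by
  have h1 : (∑ e, (if e ∈ A then (1 : ℝ) else 0) * (P.size e : ℝ)) = (P.totalSize A : ℕ) := by
    simp [totalSize, ite_mul, Finset.sum_ite_mem]
  rw [fracProfit, h1, costExt_natCast, profit]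
  simp [totalValue, ite_mul, Finset.sum_ite_mem]

/-- Taking part of an integral element is at most as profitable as taking all of it. -/
lemma density_mul_sub_cost_le (h : P.Regular) {e : U} (he : e ∈ P.integralElems) {j : ℕ}
    (hj : j ≤ P.size e) : P.density e * j - P.cost j ≤ P.profit {e} := by
  have hs : (0 : ℝ) < P.size e := by exact_mod_cast h.size_pos e
  have hj' : (j : ℝ) ≤ P.size e := by exact_mod_cast hj
  have h1 := (Finset.mem_filter.1 he).2 (j / P.size e)
    ⟨by positivity, (div_le_one hs).2 hj'⟩
  rw [fracProfit_single, fracProfit_single, div_mul_cancel₀ _ hs.ne', costExt_natCast, one_mul,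
    one_mul, costExt_natCast] at h1
  rw [profit_singleton, density]
  have : (P.value e : ℝ) / P.size e * j = j / P.size e * P.value e := by ring
  linarith

/-- An element that is not integral is less dense than its last unit of size is expensive. -/
lemma density_lt_of_notMem_integralElems (h : P.Regular) {e : U} (he : e ∉ P.integralElems) :
    P.density e < P.unitCost (P.size e) := by
  by_contra! hc
  refine he (Finset.mem_filter.2 ⟨Finset.mem_univ _, fun α hα => ?_⟩)
  have hs : (0 : ℝ) < P.size e := by exact_mod_cast h.size_pos e
  rw [fracProfit_single, fracProfit_single, one_mul, one_mul, costExt_natCast]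
  have key := costExt_le_of_forall_nat (P := P) (a := P.unitCost (P.size e))
    (b := P.unitCost (P.size e) * P.size e - P.cost (P.size e))
    (x := α * P.size e) (mul_nonneg hα.1 hs.le) (fun n => by
      have := h.unitCost_tangent (P.size e) n
      linarith)
  rw [value_eq_density_mul h]
  have : 0 ≤ (P.density e - P.unitCost (P.size e)) * ((1 - α) * P.size e) :=
    mul_nonneg (sub_nonneg.2 hc) (mul_nonneg (sub_nonneg.2 hα.2) hs.le)
  nlinarith

/-- Among the elements that are not integral, no set is more profitable than all the singletons. -/
lemma profit_le_of_disjoint_integralElems (h : P.Regular) {m : ℝ} (hm : 0 ≤ m)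
    (hsingle : ∀ e, P.profit {e} ≤ m) (A : Finset U) (hA : Disjoint A P.integralElems) :
    P.profit A ≤ m := by
  induction A using Finset.strongInduction with
  | H A ih =>
    rcases A.eq_empty_or_nonempty with rfl | hne
    · rwa [profit_empty h]
    -- Removing the least dense element never hurts while another element `e` remains: `f` is no
    -- denser than `e`, whose density is below its own last unit cost, hence below every unit cost
    -- that `f` adds.
    obtain ⟨f, hf, hmin⟩ := A.exists_min_image P.density hne
    rcases (A.erase f).eq_empty_or_nonempty with hemp | ⟨e, he⟩
    · have : A = {f} := by rw [← Finset.insert_erase hf, hemp]; rfl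
      rw [this]
      exact hsingle f
    · have hsub : A.erase f ⊂ A := Finset.erase_ssubset hf
      refine le_trans ?_ (ih _ hsub (Finset.disjoint_of_subset_left hsub.subset hA))
      have heA := Finset.mem_of_mem_erase he
      have h1 : P.density f < P.unitCost (P.totalSize (A.erase f) + 1) :=
        ((hmin e heA).trans_lt (density_lt_of_notMem_integralElems h
          (Finset.disjoint_left.1 hA heA))).trans_le
          (h.unitCost_mono ((size_le_totalSize he).trans (Nat.le_succ _)))
      have h2 := h.le_cost_add (P.totalSize (A.erase f)) (P.size f)
      conv_lhs => rw [← Finset.insert_erase hf]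
      rw [profit_insert (Finset.notMem_erase f A), value_eq_density_mul h]
      have h3 : P.density f * P.size f ≤ P.unitCost (P.totalSize (A.erase f) + 1) * P.size f := by
        gcongr
      linarith

/-- The prefix of the integral elements by density whose elements are at least as dense as the
last unit of size of the prefix ending with them is expensive. -/
noncomputable def corePrefix (P : CostInstance U) : Finset U :=
  P.integralElems.filter fun e =>
    P.unitCost (P.totalSize (P.densityPrefix Finset.univ (P.density e))) ≤ P.density e

lemma mem_densityPrefix {T : Finset U} {γ : ℝ} {e : U} :
    e ∈ P.densityPrefix T γ ↔ (e ∈ T ∧ e ∈ P.integralElems) ∧ γ ≤ P.density e := by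
  simp [densityPrefix]

lemma densityPrefix_anti (T : Finset U) {γ δ : ℝ} (hγ : γ ≤ δ) :
    P.densityPrefix T δ ⊆ P.densityPrefix T γ := fun e he => by
  rw [mem_densityPrefix] at he ⊢
  exact ⟨he.1, hγ.trans he.2⟩

lemma corePrefix_subset : P.corePrefix ⊆ P.integralElems := Finset.filter_subset _ _

lemma mem_corePrefix_of_density_le (h : P.Regular) {e f : U} (he : e ∈ P.corePrefix)
    (hf : f ∈ P.integralElems) (hef : P.density e ≤ P.density f) : f ∈ P.corePrefix :=
  Finset.mem_filter.2 ⟨hf, (h.unitCost_mono (totalSize_mono (densityPrefix_anti _ hef))).trans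
    ((Finset.mem_filter.1 he).2.trans hef)⟩

lemma densityPrefix_subset_corePrefix (h : P.Regular) {e : U} (he : e ∈ P.corePrefix)
    (T : Finset U) {γ : ℝ} (hγ : P.density e ≤ γ) : P.densityPrefix T γ ⊆ P.corePrefix :=
  fun f hf => by
    rw [mem_densityPrefix] at hf
    exact mem_corePrefix_of_density_le h he hf.1.2 (hγ.trans hf.2)

lemma densityPrefix_eq_corePrefix_inter (h : P.Regular) {T : Finset U} {l : U}
    (hl : l ∈ P.corePrefix) (hmin : ∀ e ∈ P.corePrefix ∩ T, P.density l ≤ P.density e) :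
    P.densityPrefix T (P.density l) = P.corePrefix ∩ T := by
  refine Finset.Subset.antisymm (fun e he => ?_) (fun e he => ?_)
  · exact Finset.mem_inter.2 ⟨densityPrefix_subset_corePrefix h hl T le_rfl he,
      (mem_densityPrefix.1 he).1.1⟩
  · exact mem_densityPrefix.2 ⟨⟨(Finset.mem_inter.1 he).2,
      corePrefix_subset (Finset.mem_inter.1 he).1⟩, hmin e he⟩

lemma densityDominated_corePrefix (h : P.Regular) : P.DensityDominated P.corePrefix := by
  intro e he
  obtain ⟨l, hl, hmin⟩ := P.corePrefix.exists_min_image P.density ⟨e, he⟩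
  have := densityPrefix_eq_corePrefix_inter h (T := Finset.univ) hl
    (fun e he => hmin e (Finset.mem_inter.1 he).1)
  rw [Finset.inter_univ] at this
  have h1 := (Finset.mem_filter.1 hl).2
  rw [this] at h1
  exact h1.trans (hmin e he)

/-- The Lagrangian bound: with a price that separates the core prefix from the other integral
elements, the profit of a fractional set is controlled by the conjugate of the cost. -/
lemma fracProfit_le_of_price {lam b : ℝ}
    (h : P.Regular) (hin : ∀ e ∈ P.corePrefix, lam ≤ P.density e)
    (hout : ∀ e ∈ P.integralElems, e ∉ P.corePrefix → P.density e ≤ lam)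
    (hconj : ∀ n : ℕ, lam * n - P.cost n ≤
      lam * P.totalSize P.corePrefix - P.cost (P.totalSize P.corePrefix) + b)
    {x : U → ℝ} (hx : x ∈ P.fracSubsets Finset.univ) :
    P.fracProfit x ≤ P.profit P.corePrefix + b := by
  have h1 := costExt_le_of_forall_nat (P := P) (x := ∑ e, x e * (P.size e : ℝ))
    (Finset.sum_nonneg fun e _ => mul_nonneg (hx.1 e).1 (Nat.cast_nonneg _)) hconj
  -- After pricing size at `lam`, the element part is linear in `x` and is maximized by the
  -- indicator of the core prefix.
  have h2 : ∑ e, x e * (P.value e - lam * P.size e : ℝ) ≤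
      ∑ e ∈ P.corePrefix, (P.value e - lam * P.size e : ℝ) := by
    rw [← Finset.sum_filter_add_sum_filter_not Finset.univ (· ∈ P.corePrefix)]
    have hA : ∑ e ∈ Finset.univ.filter (· ∈ P.corePrefix), x e * (P.value e - lam * P.size e : ℝ)
        ≤ ∑ e ∈ P.corePrefix, (P.value e - lam * P.size e : ℝ) := by
      rw [Finset.filter_mem_eq_inter, Finset.univ_inter]
      refine Finset.sum_le_sum fun e he => mul_le_of_le_one_left ?_ (hx.1 e).2
      rw [value_eq_density_mul h, sub_nonneg]
      exact mul_le_mul_of_nonneg_right (hin e he) (Nat.cast_nonneg _)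
    have hB : ∑ e ∈ Finset.univ.filter (¬ · ∈ P.corePrefix),
        x e * (P.value e - lam * P.size e : ℝ) ≤ 0 := by
      refine Finset.sum_nonpos fun e he => ?_
      by_cases hxe : x e = 0
      · simp [hxe]
      have heI := (Finset.mem_inter.1 (hx.2 e hxe)).2
      refine mul_nonpos_of_nonneg_of_nonpos (hx.1 e).1 ?_
      rw [value_eq_density_mul h, sub_nonpos]
      exact mul_le_mul_of_nonneg_right (hout e heI (Finset.mem_filter.1 he).2)
        (Nat.cast_nonneg _)
    linarith
  simp only [mul_sub, Finset.sum_sub_distrib] at h2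
  have h3 : ∑ e, x e * (lam * (P.size e : ℝ)) = lam * ∑ e, x e * (P.size e : ℝ) := by
    rw [Finset.mul_sum]
    exact Finset.sum_congr rfl fun e _ => by ring
  rw [h3, ← Finset.mul_sum] at h2
  rw [fracProfit, profit, totalValue]
  simp only [totalSize] at h1 ⊢
  push_cast at h1 ⊢
  linarith

/-- The price is set by the densest integral element `f` outside the core, unless the core's last
unit cost is higher. At price `P.density f`, growing the core by at most the size of `f` gains at
most the profit of `f`, by superadditivity and integrality; beyond that size each unit costs more
than the price, because `f` failed the core test. -/
lemma fracProfit_le (h : P.Regular) {m : ℝ} (hm : 0 ≤ m)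
    (hsingle : ∀ e, P.profit {e} ≤ m) {x : U → ℝ} (hx : x ∈ P.fracSubsets Finset.univ) :
    P.fracProfit x ≤ P.profit P.corePrefix + m := by
  have hdom := densityDominated_corePrefix h
  have htan := h.unitCost_tangent (P.totalSize P.corePrefix)
  set s := P.totalSize P.corePrefix with hs
  rcases (P.integralElems \ P.corePrefix).eq_empty_or_nonempty with hemp | hne
  · refine fracProfit_le_of_price h (lam := P.unitCost s) hdom (fun e he he' => ?_)
      (fun n => ?_) hx
    · exact absurd (Finset.mem_sdiff.2 ⟨he, he'⟩) (by simp [hemp])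
    · have := htan n
      rw [← hs]
      linarith
  obtain ⟨f, hf, hmax⟩ := (P.integralElems \ P.corePrefix).exists_max_image P.density hne
  obtain ⟨hfI, hfC⟩ := Finset.mem_sdiff.1 hf
  have hfmax : P.density f < P.unitCost (s + P.size f) := by
    have h1 : P.densityPrefix Finset.univ (P.density f) = insert f P.corePrefix := by
      ext e
      rw [mem_densityPrefix, Finset.mem_insert]
      constructor
      · rintro ⟨⟨-, heI⟩, hfe⟩
        by_cases heC : e ∈ P.corePrefix
        · exact Or.inr heC
        · exact Or.inl (h.density_injective
            (le_antisymm (hmax e (Finset.mem_sdiff.2 ⟨heI, heC⟩)) hfe))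
      · rintro (rfl | heC)
        · exact ⟨⟨Finset.mem_univ _, hfI⟩, le_rfl⟩
        · refine ⟨⟨Finset.mem_univ _, corePrefix_subset heC⟩, ?_⟩
          by_contra! hlt
          exact hfC (mem_corePrefix_of_density_le h heC hfI hlt.le)
    by_contra! hc
    refine hfC (Finset.mem_filter.2 ⟨hfI, ?_⟩)
    rwa [h1, totalSize_insert hfC]
  refine fracProfit_le_of_price h (lam := max (P.density f) (P.unitCost s)) (fun e he => ?_)
    (fun e he he' => le_max_of_le_left (hmax e (Finset.mem_sdiff.2 ⟨he, he'⟩)))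
    (fun n => ?_) hx
  · refine max_le ?_ (hdom e he)
    by_contra! hlt
    exact hfC (mem_corePrefix_of_density_le h he hfI hlt.le)
  rw [← hs]
  have htn := htan n
  rcases le_total n s with hns | hns
  · have h1 : (0 : ℝ) ≤ s - n := sub_nonneg.2 (by exact_mod_cast hns)
    have h2 := mul_le_mul_of_nonneg_right (le_max_right (P.density f) (P.unitCost s)) h1
    linarith
  rcases le_total (P.density f) (P.unitCost s) with hle | hle
  · rw [max_eq_right hle]
    linarith
  rw [max_eq_left hle]
  have key : ∀ j ≤ P.size f, P.density f * j - (P.cost (s + j) - P.cost s) ≤ m := by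
    intro j hj
    have h1 := density_mul_sub_cost_le h hfI hj
    have h2 := h.cost_superadditive s j
    linarith [hsingle f]
  obtain ⟨j, rfl⟩ := Nat.exists_eq_add_of_le hns
  rcases le_total j (P.size f) with hj | hj
  · have := key j hj
    push_cast
    linarith
  · obtain ⟨d, rfl⟩ := Nat.exists_eq_add_of_le hj
    have h1 := key _ le_rfl
    have h2 := h.unitCost_tangent (s + P.size f) (s + P.size f + d)
    have h3 : P.density f * d ≤ P.unitCost (s + P.size f) * d := by gcongr
    rw [← add_assoc]
    push_cast at h2 ⊢
    linarith

lemma indicator_mem_fracSubsets {A T : Finset U} (hA : A ⊆ T ∩ P.integralElems) :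
    (fun e => if e ∈ A then (1 : ℝ) else 0) ∈ P.fracSubsets T := by
  refine ⟨fun e => ?_, fun e he => hA ?_⟩
  · dsimp only
    split_ifs <;> simp
  · by_contra hc
    simp [hc] at he

lemma fracSubsets_mono {S T : Finset U} (hST : S ⊆ T) : P.fracSubsets S ⊆ P.fracSubsets T :=
  fun _ hx => ⟨hx.1, fun e he => Finset.inter_subset_inter_right hST (hx.2 e he)⟩

lemma fracOpt_le (h : P.Regular) {m : ℝ} (hm : 0 ≤ m) (hsingle : ∀ e, P.profit {e} ≤ m)
    (T : Finset U) : P.fracOpt T ≤ P.profit P.corePrefix + m := by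
  refine csSup_le ⟨_, _, indicator_mem_fracSubsets (Finset.empty_subset _), rfl⟩ ?_
  rintro _ ⟨x, hx, rfl⟩
  exact fracProfit_le h hm hsingle (fracSubsets_mono (Finset.subset_univ _) hx)

lemma profit_le_fracOpt (h : P.Regular) {m : ℝ} (hm : 0 ≤ m) (hsingle : ∀ e, P.profit {e} ≤ m)
    {A T : Finset U} (hA : A ⊆ T ∩ P.integralElems) : P.profit A ≤ P.fracOpt T := by
  refine le_csSup ⟨P.profit P.corePrefix + m, ?_⟩
    ⟨_, indicator_mem_fracSubsets hA, fracProfit_indicator A⟩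
  rintro _ ⟨x, hx, rfl⟩
  exact fracProfit_le h hm hsingle (fracSubsets_mono (Finset.subset_univ _) hx)

/-- The optimal profit exceeds the profit of the core prefix by at most twice the largest profit
of a single element. -/
lemma optProfit_le (h : P.Regular) {m : ℝ} (hm : 0 ≤ m) (hsingle : ∀ e, P.profit {e} ≤ m) :
    P.optProfit ≤ P.profit P.corePrefix + 2 * m := by
  refine Finset.sup'_le _ _ fun A _ => ?_
  have h1 := profit_union_le h (Finset.disjoint_sdiff_inter A P.integralElems)
  rw [Finset.sdiff_union_inter] at h1
  have h2 := profit_le_of_disjoint_integralElems h hm hsingle (A \ P.integralElems)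
    Finset.sdiff_disjoint
  have h3 := profit_le_fracOpt h hm hsingle (T := Finset.univ) (A := A ∩ P.integralElems)
    (Finset.inter_subset_inter_right (Finset.subset_univ _))
  have h4 := fracOpt_le h hm hsingle Finset.univ
  linarith

end Fractional

end CostInstance

/-! ### Random subsets and random orders. -/

section RandomSubset

open scoped Classical

variable {U : Type*}

/-- The variance of the weight of a uniformly random subset. -/
lemma Finset.sum_powerset_sum_sub_half_sq (w : U → ℝ) (S : Finset U) :
    ∑ X ∈ S.powerset, (∑ e ∈ X, w e - (∑ e ∈ S, w e) / 2) ^ 2 =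
      2 ^ S.card / 4 * ∑ e ∈ S, w e ^ 2 := by
  induction S using Finset.induction_on with
  | empty => simp
  | insert a S ha ih =>
    -- Pairing `X` with `insert a X` shifts the centred sum by ∓ `w a / 2`, so the cross terms
    -- cancel.
    have key : ∀ X ∈ S.powerset,
        (∑ e ∈ X, w e - (∑ e ∈ insert a S, w e) / 2) ^ 2 +
          (∑ e ∈ insert a X, w e - (∑ e ∈ insert a S, w e) / 2) ^ 2 =
        2 * (∑ e ∈ X, w e - (∑ e ∈ S, w e) / 2) ^ 2 + w a ^ 2 / 2 := by
      intro X hX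
      have haX : a ∉ X := fun hh => ha (Finset.mem_powerset.1 hX hh)
      rw [Finset.sum_insert ha, Finset.sum_insert haX]
      ring
    rw [Finset.sum_powerset_insert ha, ← Finset.sum_add_distrib, Finset.sum_congr rfl key,
      Finset.sum_add_distrib, ← Finset.mul_sum, ih, Finset.sum_const, Finset.card_powerset,
      Finset.sum_insert ha, Finset.card_insert_of_notMem ha]
    simp only [nsmul_eq_mul]
    push_cast
    ring

lemma mem_take_ofFn {n : ℕ} (σ : Fin n ≃ U) (k : ℕ) (x : U) :
    x ∈ (List.ofFn σ).take k ↔ (σ.symm x : ℕ) < k := by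
  rw [List.mem_take_iff_getElem]
  constructor
  · rintro ⟨i, hi, rfl⟩
    simp only [List.getElem_ofFn, Equiv.symm_apply_apply]
    omega
  · intro hx
    exact ⟨σ.symm x, by simpa using hx, by simp⟩

lemma mem_drop_ofFn {n : ℕ} (σ : Fin n ≃ U) (k : ℕ) (x : U) :
    x ∈ (List.ofFn σ).drop k ↔ k ≤ (σ.symm x : ℕ) := by
  rw [List.mem_drop_iff_getElem]
  constructor
  · rintro ⟨i, hi, rfl⟩
    simp
  · intro hx
    refine ⟨σ.symm x - k, ?_, ?_⟩
    · simp
      omega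
    · simp [Nat.add_sub_cancel' hx]

variable [Fintype U]

/-- Chebyshev's inequality for the weight of a uniformly random subset. -/
lemma card_filter_sum_lt_mul_sq_le (w : U → ℝ) {d : ℝ} (hd : 0 ≤ d) :
    ((Finset.univ.filter fun X : Finset U => ∑ e ∈ X, w e < (∑ e, w e) / 2 - d).card : ℝ) * d ^ 2
      ≤ 2 ^ Fintype.card U / 4 * ∑ e, w e ^ 2 := by
  rw [← Finset.card_univ, ← Finset.sum_powerset_sum_sub_half_sq w Finset.univ,
    Finset.powerset_univ, ← nsmul_eq_mul, ← Finset.sum_const]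
  refine (Finset.sum_le_sum fun X hX => ?_).trans
    (Finset.sum_le_sum_of_subset_of_nonneg (Finset.filter_subset _ _) fun _ _ _ => sq_nonneg _)
  have := (Finset.mem_filter.1 hX).2
  nlinarith

/-- If `f X + f Xᶜ ≥ c` for all `X` then at least half of the sets have `f Xᶜ ≥ c / 2`. -/
lemma two_pow_card_le_two_mul_card_filter {f : Finset U → ℝ} {c : ℝ}
    (hf : ∀ X, c ≤ f X + f Xᶜ) :
    2 ^ Fintype.card U ≤ 2 * (Finset.univ.filter fun X : Finset U => c / 2 ≤ f Xᶜ).card := by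
  have h1 : (Finset.univ.filter fun X : Finset U => ¬ c / 2 ≤ f Xᶜ).card ≤
      (Finset.univ.filter fun X : Finset U => c / 2 ≤ f Xᶜ).card := by
    refine Finset.card_le_card_of_injOn compl (fun X hX => ?_) compl_injective.injOn
    have hX := (Finset.mem_filter.1 hX).2
    refine Finset.mem_filter.2 ⟨Finset.mem_univ _, ?_⟩
    rw [compl_compl]
    linarith [hf X]
  have h2 := Finset.card_filter_add_card_filter_not (s := (Finset.univ : Finset (Finset U)))
    (fun X => c / 2 ≤ f Xᶜ)
  rw [Finset.card_univ, Fintype.card_finset] at h2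
  omega

lemma toFinset_drop_ofFn {n : ℕ} (σ : Fin n ≃ U) (k : ℕ) :
    ((List.ofFn σ).drop k).toFinset = ((List.ofFn σ).take k).toFinsetᶜ := by
  ext x
  simp [mem_take_ofFn, mem_drop_ofFn]

/-- Such orders arrange `X` and its complement independently. -/
lemma card_filter_toFinset_take_eq (X : Finset U) :
    (Finset.univ.filter fun σ : Fin (Fintype.card U) ≃ U =>
      ((List.ofFn σ).take X.card).toFinset = X).card =
      X.card.factorial * (Fintype.card U - X.card).factorial := by
  rw [← Numbering.card_prefixed]
  refine Finset.card_bij (fun σ _ => σ.symm) (fun σ hσ => ?_)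
    (fun σ _ σ' _ hh => Equiv.symm_bijective.injective hh) (fun g hg => ⟨g.symm, ?_, g.symm_symm⟩)
  · rw [Numbering.mem_prefixed]
    intro x
    rw [← mem_take_ofFn, ← List.mem_toFinset, (Finset.mem_filter.1 hσ).2]
  · rw [Numbering.mem_prefixed] at hg
    refine Finset.mem_filter.2 ⟨Finset.mem_univ _, ?_⟩
    ext x
    rw [List.mem_toFinset, mem_take_ofFn, Equiv.symm_symm]
    exact (hg x).symm

lemma card_toFinset_take_ofFn (σ : Fin (Fintype.card U) ≃ U) {k : ℕ} (hk : k ≤ Fintype.card U) :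
    ((List.ofFn σ).take k).toFinset.card = k := by
  rw [List.toFinset_card_of_nodup ((List.nodup_ofFn.2 σ.injective).sublist (List.take_sublist _ _))]
  simpa using hk

/-- The first `k` elements of a random order form a uniformly random set of size `k`. -/
lemma expect_toFinset_take (g : Finset U → ℝ) {k : ℕ} (hk : k ≤ Fintype.card U) :
    ((Fintype.card U).choose k : ℝ) *
      𝔼 σ : Fin (Fintype.card U) ≃ U, g ((List.ofFn σ).take k).toFinset =
      ∑ X ∈ Finset.powersetCard k Finset.univ, g X := by
  have h1 : ∑ σ : Fin (Fintype.card U) ≃ U, g ((List.ofFn σ).take k).toFinset =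
      ((k.factorial * (Fintype.card U - k).factorial : ℕ) : ℝ) *
        ∑ X ∈ Finset.powersetCard k Finset.univ, g X := by
    rw [← Finset.sum_fiberwise_of_maps_to (t := Finset.powersetCard k (Finset.univ : Finset U))
      (g := fun σ : Fin (Fintype.card U) ≃ U => ((List.ofFn σ).take k).toFinset), Finset.mul_sum]
    · refine Finset.sum_congr rfl fun X hX => ?_
      obtain rfl := (Finset.mem_powersetCard.1 hX).2
      rw [← card_filter_toFinset_take_eq, ← nsmul_eq_mul, ← Finset.sum_const]
      refine Finset.sum_congr rfl fun σ hσ => ?_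
      rw [(Finset.mem_filter.1 hσ).2]
    · intro σ _
      exact Finset.mem_powersetCard.2 ⟨Finset.subset_univ _, card_toFinset_take_ofFn σ hk⟩
  have h2 : ((Fintype.card (Fin (Fintype.card U) ≃ U) : ℕ) : ℝ) =
      (Fintype.card U).choose k * (k.factorial * (Fintype.card U - k).factorial : ℕ) := by
    rw [Fintype.card_equiv (Fintype.equivFin U).symm, Fintype.card_fin,
      ← Nat.choose_mul_factorial_mul_factorial hk]
    push_cast
    ring
  have h3 : ((Fintype.card U).choose k : ℝ) ≠ 0 := by exact_mod_cast (Nat.choose_pos hk).ne'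
  have h4 : ((k.factorial * (Fintype.card U - k).factorial : ℕ) : ℝ) ≠ 0 := by positivity
  rw [Fintype.expect_eq_sum_div_card, h1, h2]
  field_simp

/-- With a binomial sample size, the sample is a uniformly random set. -/
lemma expect_sum_choose_mul (g : Finset U → ℝ) :
    𝔼 σ : Fin (Fintype.card U) ≃ U, ∑ k ∈ Finset.range (Fintype.card U + 1),
      ((Fintype.card U).choose k : ℝ) / 2 ^ Fintype.card U *
        g ((List.ofFn σ).take k).toFinset = (∑ X : Finset U, g X) / 2 ^ Fintype.card U := by
  rw [Finset.expect_sum_comm, ← Finset.powerset_univ, Finset.sum_powerset, Finset.card_univ,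
    Finset.sum_div]
  refine Finset.sum_congr rfl fun k hk => ?_
  rw [← expect_toFinset_take g (Nat.lt_succ_iff.1 (Finset.mem_range.1 hk)), ← Finset.mul_expect]
  ring

/-- The probability that `a` is among the first `r` elements of a random order and `b` is not. -/
lemma expect_mem_notMem_take {a b : U} (hab : a ≠ b) {r : ℕ} (hr : 1 ≤ r)
    (hrn : r ≤ Fintype.card U) :
    (r : ℝ) * (Fintype.card U - r) ≤ Fintype.card U * (Fintype.card U - 1) *
      𝔼 σ : Fin (Fintype.card U) ≃ U,
        if a ∈ ((List.ofFn σ).take r).toFinset ∧ b ∉ ((List.ofFn σ).take r).toFinset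
          then (1 : ℝ) else 0 := by
  have h1 := expect_toFinset_take (fun X : Finset U => if a ∈ X ∧ b ∉ X then (1 : ℝ) else 0) hrn
  rw [Finset.sum_ite, Finset.sum_const_zero, add_zero, Finset.sum_const, nsmul_eq_mul,
    mul_one] at h1
  set q := 𝔼 σ : Fin (Fintype.card U) ≃ U,
        if a ∈ ((List.ofFn σ).take r).toFinset ∧ b ∉ ((List.ofFn σ).take r).toFinset
          then (1 : ℝ) else 0
  obtain ⟨r, rfl⟩ := Nat.exists_eq_add_of_le' hr
  have hn : 2 ≤ Fintype.card U := by
    rw [← Finset.card_pair hab]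
    exact Finset.card_le_univ _
  obtain ⟨n, hn⟩ := Nat.exists_eq_add_of_le' hn
  -- Adding `a` to an `r`-subset of the elements other than `a` and `b` gives such a set.
  have h2 : n.choose r ≤ ((Finset.powersetCard (r + 1) Finset.univ).filter
      fun X : Finset U => a ∈ X ∧ b ∉ X).card := by
    have hc : (Finset.univ \ {a, b} : Finset U).card = n := by
      rw [Finset.card_sdiff_of_subset (Finset.subset_univ _), Finset.card_univ,
        Finset.card_pair hab]
      omega
    rw [← hc, ← Finset.card_powersetCard]
    refine Finset.card_le_card_of_injOn (insert a) (fun X hX => ?_) (fun X hX Y hY hXY => ?_)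
    · obtain ⟨hX1, hX2⟩ := Finset.mem_powersetCard.1 hX
      have haX : a ∉ X := fun hh => by simpa using hX1 hh
      have hbX : b ∉ X := fun hh => by simpa using hX1 hh
      refine Finset.mem_filter.2 ⟨Finset.mem_powersetCard.2 ⟨Finset.subset_univ _, ?_⟩, ?_⟩
      · rw [Finset.card_insert_of_notMem haX, hX2]
      · simp [hbX, hab.symm]
    · have haX : a ∉ X := fun hh => by simpa using (Finset.mem_powersetCard.1 hX).1 hh
      have haY : a ∉ Y := fun hh => by simpa using (Finset.mem_powersetCard.1 hY).1 hh
      rw [← Finset.erase_insert haX, ← Finset.erase_insert haY, hXY]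
  have h3 : (n.choose r : ℝ) ≤ ((n + 2).choose (r + 1) : ℝ) * q := by
    rw [hn] at h1
    rw [h1]
    exact_mod_cast h2
  have h4 : ((n + 2).choose (r + 1) : ℝ) * ((r + 1) * (n + 1 - r)) =
      (n + 2) * (n + 1) * n.choose r := by
    have h5 : ((n + 2).choose (r + 1) : ℝ) * (r + 1) = (n + 2) * (n + 1).choose r := by
      have := Nat.add_one_mul_choose_eq (n + 1) r
      have : ((n + 1 + 1 : ℕ) : ℝ) * (n + 1).choose r = (n + 2).choose (r + 1) * (r + 1 : ℕ) := by
        exact_mod_cast this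
      push_cast at this
      linarith
    have h6 : ((n + 1).choose r : ℝ) * (n + 1 - r) = (n + 1) * n.choose r := by
      have := Nat.choose_mul_succ_eq n r
      have hrn' : r ≤ n + 1 := by omega
      have : (n.choose r : ℝ) * (n + 1) = (n + 1).choose r * ((n + 1 - r : ℕ) : ℝ) := by
        exact_mod_cast this
      rw [Nat.cast_sub hrn'] at this
      push_cast at this
      linarith
    linear_combination (n + 1 - r : ℝ) * h5 + (n + 2 : ℝ) * h6
  have h5 : (0 : ℝ) < (n + 2).choose (r + 1) := by
    exact_mod_cast Nat.choose_pos (by omega : r + 1 ≤ n + 2)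
  rw [hn]
  push_cast
  refine le_of_mul_le_mul_left ?_ h5
  have h7 : ((n : ℝ) + 2) * (n + 1) * n.choose r ≤
      (n + 2) * (n + 1) * ((n + 2).choose (r + 1) * q) := by gcongr
  linarith

end RandomSubset

namespace CostInstance

/-! ### The classical secretary branch. -/

section Secretary

open scoped Classical

variable {U : Type*} {P : CostInstance U}

/-- Profit and density, compared lexicographically. -/
noncomputable def profitKey (P : CostInstance U) (e : U) : ℝ ×ₗ ℝ :=
  toLex (P.profit {e}, P.density e)

lemma better_iff {a b : U} : P.Better a b ↔ P.profitKey b < P.profitKey a := by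
  simp only [Better, profitKey, Prod.Lex.lt_iff, ofLex_toLex]

lemma profitKey_injective (h : P.Regular) : Function.Injective P.profitKey := fun _ _ hab =>
  h.density_injective (congrArg Prod.snd (toLex.injective hab))

lemma profit_le_of_profitKey_le {a b : U} (hab : P.profitKey a ≤ P.profitKey b) :
    P.profit {a} ≤ P.profit {b} := by
  rcases Prod.Lex.le_iff.1 hab with hlt | heq
  · exact le_of_lt hlt
  · exact heq.1.le

variable [Fintype U]

lemma profit_secretarySelect_nonneg (h : P.Regular) (seen l : List U) :
    0 ≤ P.profit (P.secretarySelect seen l) := by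
  induction l generalizing seen with
  | nil => exact (profit_empty h).ge
  | cons e l ih =>
    rw [secretarySelect]
    split_ifs with hc
    · exact hc.2
    · exact ih _

/-- If the best element arrives after the sampling phase, and the second best one during it, then
the best element is hired. -/
lemma secretarySelect_eq (h : P.Regular) {a b : U} (hb : 0 ≤ P.profit {b})
    (hbest : ∀ e, P.profitKey e ≤ P.profitKey b)
    (hsecond : ∀ e, e ≠ b → P.profitKey e ≤ P.profitKey a)
    {seen l : List U} (ha : a ∈ seen) (hbs : b ∉ seen) (hbl : b ∈ l) :
    P.secretarySelect seen l = {b} := by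
  induction l generalizing seen with
  | nil => simp at hbl
  | cons e l ih =>
    rw [secretarySelect]
    by_cases heb : e = b
    · subst heb
      refine if_pos ⟨fun x hx => better_iff.2 ((hbest x).lt_of_ne fun hh => ?_), hb⟩
      exact hbs (profitKey_injective h hh ▸ hx)
    · rw [if_neg fun hc => (better_iff.1 (hc.1 a ha)).not_ge (hsecond e heb)]
      refine ih (List.mem_cons_of_mem _ ha) ?_ ((List.mem_cons.1 hbl).resolve_left (Ne.symm heb))
      rw [List.mem_cons, not_or]
      exact ⟨Ne.symm heb, hbs⟩

/-- A bound on the sample size of the secretary algorithm. -/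
lemma floor_div_exp_one_bounds {n : ℕ} (hn : 3 ≤ n) :
    1 ≤ ⌊(n : ℝ) / Real.exp 1⌋₊ ∧ (n : ℝ) / 5 ≤ ⌊(n : ℝ) / Real.exp 1⌋₊ ∧
      (⌊(n : ℝ) / Real.exp 1⌋₊ : ℝ) ≤ n / 2 := by
  have he1 := Real.exp_one_lt_d9
  have he2 := Real.exp_one_gt_d9
  have hn' : (3 : ℝ) ≤ n := by exact_mod_cast hn
  have hpos : (0 : ℝ) ≤ n := by linarith
  have h1 : (n : ℝ) * (36 / 100) ≤ n / Real.exp 1 := by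
    rw [le_div_iff₀ (Real.exp_pos 1)]
    nlinarith
  have h2 : (n : ℝ) / Real.exp 1 ≤ n / 2 :=
    div_le_div_of_nonneg_left hpos (by norm_num) (by linarith)
  have h3 : 1 ≤ ⌊(n : ℝ) / Real.exp 1⌋₊ := Nat.le_floor (by push_cast; linarith)
  refine ⟨h3, ?_, (Nat.floor_le (by positivity)).trans h2⟩
  have h4 := Nat.lt_floor_add_one ((n : ℝ) / Real.exp 1)
  have h5 : (1 : ℝ) ≤ ⌊(n : ℝ) / Real.exp 1⌋₊ := by exact_mod_cast h3
  -- The bound 0.36 n - 1 reaches n / 5 only from n = 7 on; smaller n use that the floor is at least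
  -- 1 or 2.
  rcases le_or_gt n 5 with h6 | h6
  · have : (n : ℝ) ≤ 5 := by exact_mod_cast h6
    linarith
  · have : (6 : ℝ) ≤ n := by exact_mod_cast h6
    rcases le_or_gt n 10 with h7 | h7
    · have h8 : 2 ≤ ⌊(n : ℝ) / Real.exp 1⌋₊ := Nat.le_floor (by push_cast; linarith)
      have h9 : (2 : ℝ) ≤ ⌊(n : ℝ) / Real.exp 1⌋₊ := by exact_mod_cast h8
      have : (n : ℝ) ≤ 10 := by exact_mod_cast h7
      linarith
    · have : (11 : ℝ) ≤ n := by exact_mod_cast h7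
      linarith

lemma floor_div_exp_one_eq_zero {n : ℕ} (hn : n ≤ 2) : ⌊(n : ℝ) / Real.exp 1⌋₊ = 0 := by
  rw [Nat.floor_eq_zero, div_lt_one (Real.exp_pos 1)]
  have hn' : (n : ℝ) ≤ 2 := by exact_mod_cast hn
  linarith [Real.exp_one_gt_d9]

lemma profit_secretary_nonneg (h : P.Regular) (l : List U) : 0 ≤ P.profit (P.secretary l) :=
  profit_secretarySelect_nonneg h _ _

/-- The secretary algorithm earns in expectation a constant fraction of the largest profit of a
single element. -/
lemma le_expect_profit_secretary (h : P.Regular) {b : U} (hb : 0 ≤ P.profit {b})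
    (hbest : ∀ e, P.profitKey e ≤ P.profitKey b) :
    P.profit {b} / 10 ≤
      𝔼 σ : Fin (Fintype.card U) ≃ U, P.profit (P.secretary (List.ofFn σ)) := by
  have hposcard : 1 ≤ Fintype.card U := Fintype.card_pos_iff.2 ⟨b⟩
  have main : ∀ (q : (Fin (Fintype.card U) ≃ U) → Prop) [DecidablePred q],
      (∀ σ, q σ → P.secretary (List.ofFn σ) = {b}) →
      1 / 10 ≤ 𝔼 σ, (if q σ then (1 : ℝ) else 0) →
      P.profit {b} / 10 ≤
        𝔼 σ : Fin (Fintype.card U) ≃ U, P.profit (P.secretary (List.ofFn σ)) := by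
    intro q _ hq hprob
    have h1 : P.profit {b} * 𝔼 σ, (if q σ then (1 : ℝ) else 0) ≤
        𝔼 σ : Fin (Fintype.card U) ≃ U, P.profit (P.secretary (List.ofFn σ)) := by
      rw [Finset.mul_expect]
      refine Finset.expect_le_expect fun σ _ => ?_
      split_ifs with hc
      · rw [hq σ hc, mul_one]
      · rw [mul_zero]
        exact profit_secretary_nonneg h _
    have h2 := mul_le_mul_of_nonneg_left hprob hb
    linarith
  -- For n ≤ 2 nothing is sampled, and the best element comes first with probability at least 1/2.
  -- Otherwise the event is that the runner-up `a` is sampled and `b` is not.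
  rcases le_or_gt (Fintype.card U) 2 with hn | hn
  · refine main (fun σ => b ∈ ((List.ofFn σ).take 1).toFinset) (fun σ hσ => ?_) ?_
    · rw [List.mem_toFinset] at hσ
      rw [secretary, List.length_ofFn, floor_div_exp_one_eq_zero hn, List.take_zero, List.drop_zero]
      match hl : List.ofFn σ, hσ with
      | [], hσ => simp at hσ
      | e :: l, hσ =>
        obtain rfl : b = e := by simpa using hσ
        rw [secretarySelect, if_pos ⟨by simp, hb⟩]
    · have h1 := expect_toFinset_take (fun X : Finset U => if b ∈ X then (1 : ℝ) else 0) hposcard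
      have h2 : (1 : ℝ) ≤ ∑ X ∈ Finset.powersetCard 1 (Finset.univ : Finset U),
          if b ∈ X then (1 : ℝ) else 0 := by
        refine le_trans ?_ (Finset.single_le_sum
          (f := fun X : Finset U => if b ∈ X then (1 : ℝ) else 0) (a := {b})
          (fun X _ => by split_ifs <;> norm_num)
          (Finset.mem_powersetCard.2 ⟨Finset.subset_univ _, Finset.card_singleton b⟩))
        simp
      rw [← h1, Nat.choose_one_right] at h2
      have hn' : (Fintype.card U : ℝ) ≤ 2 := by exact_mod_cast hn
      have hn'' : (1 : ℝ) ≤ Fintype.card U := by exact_mod_cast hposcard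
      by_contra! hc
      nlinarith
  · obtain ⟨hr1, hr2, hr3⟩ := floor_div_exp_one_bounds hn
    set r := ⌊(Fintype.card U : ℝ) / Real.exp 1⌋₊ with hr
    have hn' : (3 : ℝ) ≤ Fintype.card U := by exact_mod_cast hn
    have hne : (Finset.univ.erase b : Finset U).Nonempty := by
      rw [← Finset.card_pos, Finset.card_erase_of_mem (Finset.mem_univ _), Finset.card_univ]
      omega
    obtain ⟨a, ha, hmax⟩ := (Finset.univ.erase b).exists_max_image P.profitKey hne
    have hab : a ≠ b := Finset.ne_of_mem_erase ha
    refine main (fun σ => a ∈ ((List.ofFn σ).take r).toFinset ∧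
      b ∉ ((List.ofFn σ).take r).toFinset) (fun σ hσ => ?_) ?_
    · rw [secretary, List.length_ofFn, ← hr]
      refine secretarySelect_eq h hb hbest
        (fun e he => hmax e (Finset.mem_erase.2 ⟨he, Finset.mem_univ _⟩))
        (List.mem_toFinset.1 hσ.1) (fun hh => hσ.2 (List.mem_toFinset.2 hh)) ?_
      rw [← List.mem_toFinset, toFinset_drop_ofFn, Finset.mem_compl]
      exact hσ.2
    · have hrn : r ≤ Fintype.card U := by
        have : (r : ℝ) ≤ Fintype.card U := by linarith
        exact_mod_cast this
      have h1 := expect_mem_notMem_take hab hr1 hrn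
      by_contra! hc
      have h2 : (0 : ℝ) < Fintype.card U * (Fintype.card U - 1) :=
        mul_pos (by linarith) (by linarith)
      have h3 := h1.trans_lt (mul_lt_mul_of_pos_left hc h2)
      have h4 : (Fintype.card U / 5 : ℝ) * (Fintype.card U / 2) ≤ r * (Fintype.card U - r) :=
        mul_le_mul hr2 (by linarith) (by linarith) (by linarith)
      nlinarith

end Secretary

/-! ### The greedy phase. -/

section Greedy

open scoped Classical

variable {U : Type*} [Fintype U] {P : CostInstance U}

lemma profit_le_greedyStep (τ : WithTop ℝ) (O : Finset U) (e : U) :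
    P.profit O ≤ P.profit (P.greedyStep τ O e) := by
  rw [greedyStep]
  split_ifs with hc
  · exact sub_nonneg.1 hc.1
  · exact le_rfl

lemma profit_le_foldl_greedyStep (τ : WithTop ℝ) (l : List U) (O : Finset U) :
    P.profit O ≤ P.profit (l.foldl (P.greedyStep τ) O) := by
  induction l generalizing O with
  | nil => exact le_rfl
  | cons e l ih => exact (profit_le_greedyStep τ O e).trans (ih _)

lemma profit_sampleAndGreedy_nonneg (h : P.Regular) (β k₁ : ℝ) (l : List U) (k : ℕ) :
    0 ≤ P.profit (P.sampleAndGreedy β k₁ l k) :=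
  (profit_empty h).ge.trans (profit_le_foldl_greedyStep _ _ _)

/-- With a threshold inside a density dominated set, the greedy phase takes everything above the
threshold. -/
lemma foldl_greedyStep_eq (h : P.Regular) {S : Finset U} (hS : P.DensityDominated S) {τ : ℝ}
    (hτ : P.densityPrefix Finset.univ τ ⊆ S) (l : List U) (O : Finset U) (hO : O ⊆ S) :
    l.foldl (P.greedyStep (τ : WithTop ℝ)) O = O ∪ P.densityPrefix l.toFinset τ := by
  induction l generalizing O with
  | nil => simp [densityPrefix]
  | cons e l ih =>
    rw [List.foldl_cons]
    by_cases he : e ∈ P.densityPrefix Finset.univ τ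
    · have hins : insert e O ⊆ S := Finset.insert_subset (hτ he) hO
      have he' := mem_densityPrefix.1 he
      have hstep : P.greedyStep (τ : WithTop ℝ) O e = insert e O :=
        if_pos ⟨sub_nonneg.2 (hS.profit_mono h (Finset.subset_insert _ _) hins),
          WithTop.coe_le_coe.2 he'.2, he'.1.2⟩
      rw [hstep, ih _ hins]
      ext x
      by_cases hx : x = e
      · subst hx
        simp [mem_densityPrefix, he'.1.2, he'.2]
      · simp [mem_densityPrefix, hx]
    · have hstep : P.greedyStep (τ : WithTop ℝ) O e = O :=
        if_neg fun hc => he (mem_densityPrefix.2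
          ⟨⟨Finset.mem_univ _, hc.2.2⟩, WithTop.coe_le_coe.1 hc.2.1⟩)
      rw [hstep, ih _ hO]
      ext x
      by_cases hx : x = e
      · subst hx
        simp only [mem_densityPrefix, Finset.mem_univ, true_and] at he
        simp only [Finset.mem_union, mem_densityPrefix]
        tauto
      · simp [mem_densityPrefix, hx]

end Greedy

end CostInstance

namespace CostInstance

/-! ### Learning the threshold and the competitive ratio. -/

section Competitive

open scoped Classical

variable {U : Type*} [Fintype U] {P : CostInstance U}

/-- The learned threshold is the largest density of a candidate. -/
lemma exists_threshold_eq {β k₁ : ℝ} {X : Finset U} {l : U}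
    (hl : l ∈ P.thresholdCandidates β k₁ X) :
    ∃ t ∈ P.thresholdCandidates β k₁ X, P.density l ≤ P.density t ∧
      P.threshold β k₁ X = (P.density t : WithTop ℝ) := by
  have hne : (P.thresholdCandidates β k₁ X).Nonempty := ⟨l, hl⟩
  obtain ⟨t, ht, hsup⟩ := Finset.exists_mem_eq_sup' hne P.density
  refine ⟨t, ht, hsup ▸ Finset.le_sup' P.density hl, ?_⟩
  rw [threshold, dif_pos hne, hsup]

/-- Among the density prefixes inside the core prefix with profit at least `L` there is a
smallest one. -/
lemma exists_least_prefix (h : P.Regular) {L : ℝ} (hL : 0 < L) (hLM : L ≤ P.profit P.corePrefix) :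
    ∃ J ⊆ P.corePrefix, L ≤ P.profit J ∧ ∀ t ∈ P.corePrefix,
      L ≤ P.profit (P.densityPrefix Finset.univ (P.density t)) →
        J ⊆ P.densityPrefix Finset.univ (P.density t) := by
  have hne : P.corePrefix.Nonempty := by
    rw [Finset.nonempty_iff_ne_empty]
    intro hemp
    rw [hemp, profit_empty h] at hLM
    linarith
  obtain ⟨l, hl, hmin⟩ := P.corePrefix.exists_min_image P.density hne
  have hpre := densityPrefix_eq_corePrefix_inter h (T := Finset.univ) hl
    (fun e he => hmin e (Finset.mem_inter.1 he).1)
  rw [Finset.inter_univ] at hpre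
  obtain ⟨e, he, hmax⟩ := (P.corePrefix.filter fun t =>
    L ≤ P.profit (P.densityPrefix Finset.univ (P.density t))).exists_max_image P.density
      ⟨l, Finset.mem_filter.2 ⟨hl, by rwa [hpre]⟩⟩
  obtain ⟨heC, heL⟩ := Finset.mem_filter.1 he
  exact ⟨_, densityPrefix_subset_corePrefix h heC _ le_rfl, heL, fun t ht htL =>
    densityPrefix_anti _ (hmax t (Finset.mem_filter.2 ⟨ht, htL⟩))⟩

/-- If the sample captures enough of the core prefix, then the greedy phase collects all the
unsampled elements of every sufficiently small density prefix. -/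
lemma profit_inter_compl_le_sampleAndGreedy (h : P.Regular) {β k₁ L : ℝ} {J : Finset U}
    (hJ : ∀ t ∈ P.corePrefix, L ≤ P.profit (P.densityPrefix Finset.univ (P.density t)) →
      J ⊆ P.densityPrefix Finset.univ (P.density t))
    (σ : Fin (Fintype.card U) ≃ U) (k : ℕ) {X : Finset U}
    (hX : ((List.ofFn σ).take k).toFinset = X)
    (hpos : 0 < P.profit (P.corePrefix ∩ X))
    (hcore : β * (1 - 1 / k₁) * P.fracOpt X ≤ P.profit (P.corePrefix ∩ X))
    (hL : L ≤ β * (1 - 1 / k₁) * P.fracOpt X) :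
    P.profit (J ∩ Xᶜ) ≤ P.profit (P.sampleAndGreedy β k₁ (List.ofFn σ) k) := by
  have hdom := densityDominated_corePrefix h
  have hne : (P.corePrefix ∩ X).Nonempty := by
    rw [Finset.nonempty_iff_ne_empty]
    intro hemp
    rw [hemp, profit_empty h] at hpos
    exact lt_irrefl _ hpos
  obtain ⟨l, hl, hmin⟩ := (P.corePrefix ∩ X).exists_min_image P.density hne
  obtain ⟨hlC, hlX⟩ := Finset.mem_inter.1 hl
  -- The sampled prefix ending at the least dense sampled core element is exactly the sampled core,
  -- so `hcore` makes it a candidate.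
  have hlcand : l ∈ P.thresholdCandidates β k₁ X := by
    refine Finset.mem_filter.2 ⟨Finset.mem_inter.2 ⟨hlX, corePrefix_subset hlC⟩, ?_⟩
    rwa [densityPrefix_eq_corePrefix_inter h hlC hmin]
  obtain ⟨t, ht, hlt, hthr⟩ := exists_threshold_eq hlcand
  obtain ⟨htXI, htprofit⟩ := Finset.mem_filter.1 ht
  have htC : t ∈ P.corePrefix :=
    mem_corePrefix_of_density_le h hlC (Finset.mem_inter.1 htXI).2 hlt
  have hpre := densityPrefix_subset_corePrefix h htC Finset.univ le_rfl
  have hsub : ∀ T : Finset U, P.densityPrefix T (P.density t) ⊆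
      P.densityPrefix Finset.univ (P.density t) := fun T e he => by
    rw [mem_densityPrefix] at he ⊢
    exact ⟨⟨Finset.mem_univ _, he.1.2⟩, he.2⟩
  -- The sampled prefix at `t` already earns `L`, and adding the unsampled elements keeps it inside
  -- the core, where profit is monotone.
  have hJt := hJ t htC ((hL.trans htprofit).trans (hdom.profit_mono h (hsub X) hpre))
  rw [sampleAndGreedy, hX, hthr, foldl_greedyStep_eq h hdom hpre _ _ (Finset.empty_subset _),
    Finset.empty_union, toFinset_drop_ofFn, hX]
  refine hdom.profit_mono h (fun e he => ?_) ((hsub _).trans hpre)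
  obtain ⟨heJ, heX⟩ := Finset.mem_inter.1 he
  have := mem_densityPrefix.1 (hJt heJ)
  exact mem_densityPrefix.2 ⟨⟨heX, this.1.2⟩, this.2⟩

/-- With probability at least `3 / 4` a random set captures more than a quarter of the profit of
the core prefix, if no single element has a large profit. -/
lemma three_mul_two_pow_card_le (h : P.Regular) {m : ℝ} (hsingle : ∀ e, P.profit {e} ≤ m)
    (hM : 20 * m < P.profit P.corePrefix) (hMpos : 0 < P.profit P.corePrefix) :
    3 * 2 ^ Fintype.card U ≤ 4 * (Finset.univ.filter fun X : Finset U =>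
      0.273 * P.profit P.corePrefix ≤ P.profit (P.corePrefix ∩ X)).card := by
  set M := P.profit P.corePrefix with hMdef
  set w : U → ℝ := fun e => if e ∈ P.corePrefix then P.profitShare P.corePrefix e else 0 with hw
  have hwX : ∀ X : Finset U, ∑ e ∈ X, w e ≤ P.profit (P.corePrefix ∩ X) := by
    intro X
    rw [hw, Finset.sum_ite_mem, Finset.inter_comm]
    exact sum_profitShare_le h Finset.inter_subset_left
  have hwsum : ∑ e, w e = M := by
    rw [hw, Finset.sum_ite_mem, Finset.univ_inter, sum_profitShare_self h]
  have hw0 : ∀ e, 0 ≤ w e := by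
    intro e
    simp only [hw]
    split_ifs with he
    · exact (densityDominated_corePrefix h).profitShare_nonneg h he
    · exact le_rfl
  have hwm : ∀ e, w e ≤ M / 20 := by
    intro e
    simp only [hw]
    split_ifs with he
    · have := (profitShare_le h he).trans (hsingle e)
      linarith
    · positivity
  have hsq : ∑ e, w e ^ 2 ≤ M ^ 2 / 20 := by
    calc ∑ e, w e ^ 2 ≤ ∑ e, M / 20 * w e := Finset.sum_le_sum fun e _ => by
          rw [pow_two]
          exact mul_le_mul_of_nonneg_right (hwm e) (hw0 e)
      _ = M ^ 2 / 20 := by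
          rw [← Finset.mul_sum, hwsum]
          ring
  -- The deviation 0.227 is 1/2 - 0.273. The variance is at most M²/80, and (1/80)/0.227² < 1/4.
  have hcheb := card_filter_sum_lt_mul_sq_le w (d := 0.227 * M) (by positivity)
  rw [hwsum] at hcheb
  set F := Finset.univ.filter fun X : Finset U => ∑ e ∈ X, w e < M / 2 - 0.227 * M with hF
  have hbad : 4 * F.card ≤ 2 ^ Fintype.card U := by
    have h1 : (F.card : ℝ) * (0.227 * M) ^ 2 ≤ 2 ^ Fintype.card U / 4 * (M ^ 2 / 20) :=
      hcheb.trans (by gcongr)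
    have h2 : (F.card : ℝ) * 0.227 ^ 2 ≤ 2 ^ Fintype.card U / 80 := by
      refine le_of_mul_le_mul_right ?_ (pow_pos hMpos 2)
      linarith
    have h3 : (4 * F.card : ℝ) ≤ 2 ^ Fintype.card U := by
      have : (0 : ℝ) ≤ F.card := Nat.cast_nonneg _
      norm_num at h2
      linarith
    exact_mod_cast h3
  have hcover : (2 : ℕ) ^ Fintype.card U ≤ F.card + (Finset.univ.filter fun X : Finset U =>
      0.273 * M ≤ P.profit (P.corePrefix ∩ X)).card := by
    rw [← Fintype.card_finset, ← Finset.card_univ]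
    refine le_trans (Finset.card_le_card fun X _ => ?_) (Finset.card_union_le _ _)
    rw [Finset.mem_union, hF, Finset.mem_filter, Finset.mem_filter]
    rcases lt_or_ge (∑ e ∈ X, w e) (M / 2 - 0.227 * M) with hlt | hge
    · exact Or.inl ⟨Finset.mem_univ _, hlt⟩
    · refine Or.inr ⟨Finset.mem_univ _, ?_⟩
      have := hwX X
      linarith
  omega

/-- If no single element has a large profit, then the sampling phase followed by the greedy phase
earns in expectation a constant fraction of the profit of the core prefix. -/
lemma le_expect_profit_sampleAndGreedy (h : P.Regular) {m : ℝ} (hm : 0 ≤ m)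
    (hsingle : ∀ e, P.profit {e} ≤ m) (hM : 20 * m < P.profit P.corePrefix) :
    P.profit P.corePrefix / 200 ≤ 𝔼 σ : Fin (Fintype.card U) ≃ U,
      ∑ k ∈ Finset.range (Fintype.card U + 1),
        ((Fintype.card U).choose k : ℝ) / 2 ^ Fintype.card U *
          P.profit (P.sampleAndGreedy 0.262 112 (List.ofFn σ) k) := by
  have hMpos : 0 < P.profit P.corePrefix := by linarith
  have hA := three_mul_two_pow_card_le h hsingle hM hMpos
  set M := P.profit P.corePrefix with hMdef
  -- The level 0.07 lies just below 0.262 · (111/112) · 0.273, a lower bound for the candidate level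
  -- relative to M on the good event.
  obtain ⟨J, hJC, hJL, hJ⟩ := exists_least_prefix h (L := 0.07 * M) (by positivity) (by linarith)
  have hB := two_pow_card_le_two_mul_card_filter (f := fun X => P.profit (J ∩ X))
    (c := P.profit J) (fun X => by
      have := profit_union_le h (A := J ∩ X) (B := J ∩ Xᶜ)
        (disjoint_compl_right.mono Finset.inter_subset_right Finset.inter_subset_right)
      rwa [← Finset.inter_union_distrib_left, Finset.union_compl, Finset.inter_univ] at this)
  set A := Finset.univ.filter fun X : Finset U =>
    0.273 * M ≤ P.profit (P.corePrefix ∩ X) with hAdef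
  set B := Finset.univ.filter fun X : Finset U => P.profit J / 2 ≤ P.profit (J ∩ Xᶜ) with hBdef
  have hAB : 2 ^ Fintype.card U ≤ 4 * (A ∩ B).card := by
    have h1 := Finset.card_union_add_card_inter A B
    have h2 := Finset.card_le_univ (A ∪ B)
    rw [Fintype.card_finset] at h2
    omega
  have hAB' : (2 : ℝ) ^ Fintype.card U ≤ 4 * (A ∩ B).card := by exact_mod_cast hAB
  have hgood : ∀ (σ : Fin (Fintype.card U) ≃ U) (k : ℕ),
      (if ((List.ofFn σ).take k).toFinset ∈ A ∩ B then 0.035 * M else 0) ≤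
        P.profit (P.sampleAndGreedy 0.262 112 (List.ofFn σ) k) := by
    intro σ k
    split_ifs with hc
    · obtain ⟨hcA, hcB⟩ := Finset.mem_inter.1 hc
      have hXA := (Finset.mem_filter.1 hcA).2
      have hXB := (Finset.mem_filter.1 hcB).2
      have hupper := fracOpt_le h hm hsingle ((List.ofFn σ).take k).toFinset
      have hlower := profit_le_fracOpt h hm hsingle
        (A := P.corePrefix ∩ ((List.ofFn σ).take k).toFinset)
        (T := ((List.ofFn σ).take k).toFinset)
        (Finset.subset_inter Finset.inter_subset_right
          (Finset.inter_subset_left.trans corePrefix_subset))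
      -- Here `fracOpt` is at most M + m ≤ 1.05 M, and 0.262 · (111/112) · 1.05 < 0.273, so the
      -- sampled core passes the test.
      have := profit_inter_compl_le_sampleAndGreedy h (β := 0.262) (k₁ := 112) hJ σ k rfl
        (by linarith) (by norm_num; linarith) (by norm_num; linarith)
      linarith
    · exact profit_sampleAndGreedy_nonneg h _ _ _ _
  have hexp := expect_sum_choose_mul (fun X : Finset U => if X ∈ A ∩ B then 0.035 * M else 0)
  rw [Finset.sum_ite_mem, Finset.univ_inter, Finset.sum_const, nsmul_eq_mul] at hexp
  have hlow : M / 200 ≤ ((A ∩ B).card : ℝ) * (0.035 * M) / 2 ^ Fintype.card U := by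
    rw [le_div_iff₀ (by positivity)]
    nlinarith
  refine (hlow.trans hexp.ge).trans (Finset.expect_le_expect fun σ _ =>
    Finset.sum_le_sum fun k _ => ?_)
  exact mul_le_mul_of_nonneg_left (hgood σ k) (by positivity)

lemma optProfit_le_mul_expectedProfit (h : P.Regular) :
    P.optProfit ≤ 616 * P.expectedProfit 0.262 112 := by
  have hE : P.expectedProfit 0.262 112 =
      1 / 2 * (𝔼 σ : Fin (Fintype.card U) ≃ U, P.profit (P.secretary (List.ofFn σ))) +
      1 / 2 * 𝔼 σ : Fin (Fintype.card U) ≃ U,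
        ∑ k ∈ Finset.range (Fintype.card U + 1),
          ((Fintype.card U).choose k : ℝ) / 2 ^ Fintype.card U *
            P.profit (P.sampleAndGreedy 0.262 112 (List.ofFn σ) k) := by
    rw [expectedProfit, Finset.expect_add_distrib, ← Finset.mul_expect, ← Finset.mul_expect]
  have hsec0 : 0 ≤ 𝔼 σ : Fin (Fintype.card U) ≃ U, P.profit (P.secretary (List.ofFn σ)) :=
    Finset.expect_nonneg fun σ _ => profit_secretary_nonneg h _
  have hgreedy0 : 0 ≤ 𝔼 σ : Fin (Fintype.card U) ≃ U,
      ∑ k ∈ Finset.range (Fintype.card U + 1),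
        ((Fintype.card U).choose k : ℝ) / 2 ^ Fintype.card U *
          P.profit (P.sampleAndGreedy 0.262 112 (List.ofFn σ) k) :=
    Finset.expect_nonneg fun σ _ => Finset.sum_nonneg fun k _ =>
      mul_nonneg (by positivity) (profit_sampleAndGreedy_nonneg h _ _ _ _)
  obtain ⟨m, hm, hsingle, hsec⟩ : ∃ m : ℝ, 0 ≤ m ∧ (∀ e, P.profit {e} ≤ m) ∧
      m / 10 ≤ 𝔼 σ : Fin (Fintype.card U) ≃ U, P.profit (P.secretary (List.ofFn σ)) := by
    by_cases hex : ∃ e, 0 < P.profit {e}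
    · obtain ⟨e, he⟩ := hex
      obtain ⟨b, -, hb⟩ := Finset.univ.exists_max_image P.profitKey ⟨e, Finset.mem_univ _⟩
      have hb' : ∀ x, P.profitKey x ≤ P.profitKey b := fun x => hb x (Finset.mem_univ _)
      have hb0 : 0 ≤ P.profit {b} := he.le.trans (profit_le_of_profitKey_le (hb' e))
      exact ⟨_, hb0, fun x => profit_le_of_profitKey_le (hb' x),
        le_expect_profit_secretary h hb0 hb'⟩
    · push Not at hex
      exact ⟨0, le_rfl, hex, by simpa using hsec0⟩
  have hopt := optProfit_le h hm hsingle
  rw [hE]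
  -- With the fair coin, the first case needs 22 m ≤ (616/20) m and the second 1.1 M ≤ (616/400) M.
  rcases le_or_gt (P.profit P.corePrefix) (20 * m) with hM | hM
  · linarith
  · have := le_expect_profit_sampleAndGreedy h hm hsingle hM
    linarith

end Competitive

end CostInstance

theorem theorem1 {U : Type*} [Fintype U] (P : CostInstance U)
    (size_pos : ∀ e, 0 < P.size e)
    (density_injective : Function.Injective P.density)
    (cost_zero : P.cost 0 = 0)
    (cost_mono : Monotone P.cost)
    (cost_convex : ∀ t, 2 * P.cost (t + 1) ≤ P.cost t + P.cost (t + 2)) :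
    P.optProfit ≤ 616 * P.expectedProfit 0.262 112 :=
  CostInstance.optProfit_le_mul_expectedProfit
    ⟨size_pos, density_injective, cost_zero, cost_mono, cost_convex⟩
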